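/- Let $X$ be a complete $\mathrm{CAT}(0)$ space with metric $d$ and fix a reference point $o\in X$. A geodesic ray is a map $c:[0,\infty)\to X$ with $d(c(x),c(y))=|x-y|$ for all $x,y\ge 0$; the boundary at infinity $\partial X$ is the set of equivalence classes of geodesic rays, where $c,c'$ are equivalent if $\sup_{x\ge 0} d(c(x),c'(x))<\infty$. For $\xi,\zeta\in\partial X$ and $p\in X$ let $\angle_p(\xi,\zeta)$ be the (Alexandrov) angle at $p$ between the rays in $\xi$ and $\zeta$ that emanate from $p$, and let $\angle(\xi,\zeta)=\sup_{p\in X}\angle_p(\xi,\zeta)$ be the angular metric. Let $\mathcal U$ be the family of unbounded subsets of $X$. For $R,S\in\mathcal U$ let $s^+(R,S)$ be the infimum of all $\alpha\ge 0$ such that $S\subseteq\bigcup_{x\in R}B(x,\alpha d(o,x)+a)$ for some $a\ge 0$ (with $B(x,r)$ the closed ball), and put $s(R,S)=\max\{s^+(R,S),s^+(S,R)\}$ and $t(R,S)=\sqrt{s(R,S)}$. Write $R\sim S$ if $s(R,S)=0$; this is an equivalence relation and $t$ induces a metric on $\mathcal U/{\sim}$. Let $\mathcal G\subseteq\mathcal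 U$ be the family of all images $c([0,\infty))$ of geodesic rays $c$ in $X$ (with arbitrary origin), and let $\mathcal G/{\sim}=\{[R] : R\in\mathcal G\}\subseteq\mathcal U/{\sim}$. Then for each $p\in X$ and $\xi\in\partial X$ there is exactly one geodesic ray in $\xi$ that emanates from $p$. Let $R_\xi$ be the image of the ray in $\xi$ that emanates from $o$. The map $\partial X\to\mathcal G/{\sim}$, $\xi\mapsto[R_\xi]$, is a bijection, and it is bi-Hölder: $$\tfrac1\pi\angle(\xi,\zeta)\le\bigl(t([R_\xi],[R_\zeta])\bigr)^2\le\angle(\xi,\zeta)\qquad\text{for all }\xi,\zeta\in\partial X.$$ Furthermore, $\mathcal G/{\sim}$ is a closed subset of the metric space $(\mathcal U/{\sim},t)$. -/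

import Mathlib

open Set Filter Topology
open scoped NNReal

noncomputable section

namespace AngleMetric

/-! ### Unbounded subsets and linear equivalence -/

section Unbounded

variable {X : Type*} [MetricSpace X]

/-- The family `𝓤` of unbounded subsets of a metric space. -/
def Unbounded (X : Type*) [MetricSpace X] : Type _ :=
  {R : Set X // ¬ Bornology.IsBounded R}

/-- The set `α R + a`, the union of the closed balls `B(x, α d(o,x) + a)` over `x ∈ R`. -/
def fatten (o : X) (α : ℝ) (R : Set X) (a : ℝ) : Set X :=
  ⋃ x ∈ R, Metric.closedBall x (α * dist o x + a)

/-- `s⁺(R,S)`: the infimum of all `α ≥ 0` such that `S ⊆ α R + a` for some `a ≥ 0`. -/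
def sPlus (o : X) (R S : Unbounded X) : ℝ :=
  sInf {α : ℝ | 0 ≤ α ∧ ∃ a : ℝ, 0 ≤ a ∧ S.1 ⊆ fatten o α R.1 a}

/-- `s(R,S) = max {s⁺(R,S), s⁺(S,R)}`. -/
def sDist (o : X) (R S : Unbounded X) : ℝ :=
  max (sPlus o R S) (sPlus o S R)

/-- `t(R,S) = √ s(R,S)`. -/
def tDist (o : X) (R S : Unbounded X) : ℝ :=
  Real.sqrt (sDist o R S)

theorem mem_fatten {o : X} {α a : ℝ} {R : Set X} {y : X} :
    y ∈ fatten o α R a ↔ ∃ x ∈ R, dist y x ≤ α * dist o x + a := by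
  simp [fatten]

theorem bddBelow_sPlus (o : X) (R S : Unbounded X) :
    BddBelow {α : ℝ | 0 ≤ α ∧ ∃ a : ℝ, 0 ≤ a ∧ S.1 ⊆ fatten o α R.1 a} :=
  ⟨0, fun _ h => h.1⟩

theorem nonempty_sPlus (o : X) (R S : Unbounded X) :
    {α : ℝ | 0 ≤ α ∧ ∃ a : ℝ, 0 ≤ a ∧ S.1 ⊆ fatten o α R.1 a}.Nonempty := by
  refine ⟨2, by norm_num, 0, le_rfl, fun y _ => ?_⟩
  rw [mem_fatten]
  by_contra hcon
  push Not at hcon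
  refine R.2 ((Metric.isBounded_closedBall (x := o) (r := dist o y)).subset fun x hx => ?_)
  have h1 := hcon x hx
  have h2 := dist_triangle y o x
  rw [Metric.mem_closedBall, dist_comm x o]
  rw [dist_comm y o] at h2
  linarith

theorem sPlus_nonneg (o : X) (R S : Unbounded X) : 0 ≤ sPlus o R S :=
  Real.sInf_nonneg fun _ h => h.1

theorem sDist_nonneg (o : X) (R S : Unbounded X) : 0 ≤ sDist o R S :=
  le_max_of_le_left (sPlus_nonneg o R S)

theorem sPlus_self (o : X) (R : Unbounded X) : sPlus o R R = 0 := by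
  refine le_antisymm (csInf_le (bddBelow_sPlus o R R) ⟨le_rfl, 0, le_rfl, fun y hy => ?_⟩)
    (sPlus_nonneg o R R)
  exact mem_fatten.2 ⟨y, hy, by simp⟩

theorem subset_fatten_of_sPlus_lt {o : X} {R S : Unbounded X} {α : ℝ} (h : sPlus o R S < α) :
    ∃ a : ℝ, 0 ≤ a ∧ S.1 ⊆ fatten o α R.1 a := by
  obtain ⟨β, ⟨_, a, ha, hS⟩, hβ⟩ := exists_lt_of_csInf_lt (nonempty_sPlus o R S) h
  refine ⟨a, ha, fun y hy => ?_⟩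
  obtain ⟨x, hx, hyx⟩ := mem_fatten.1 (hS hy)
  refine mem_fatten.2 ⟨x, hx, hyx.trans ?_⟩
  gcongr

theorem sPlus_triangle (o : X) (R S T : Unbounded X) :
    sPlus o R T ≤ sPlus o R S + sPlus o R S * sPlus o S T + sPlus o S T := by
  have key : ∀ ε : ℝ, 0 < ε → sPlus o R T ≤
      (sPlus o R S + ε) + (sPlus o R S + ε) * (sPlus o S T + ε) + (sPlus o S T + ε) := by
    intro ε hε
    have h1 := sPlus_nonneg o R S
    have h2 := sPlus_nonneg o S T
    obtain ⟨a, ha, hS⟩ := subset_fatten_of_sPlus_lt (lt_add_of_pos_right (sPlus o R S) hε)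
    obtain ⟨b, hb, hT⟩ := subset_fatten_of_sPlus_lt (lt_add_of_pos_right (sPlus o S T) hε)
    have hα : 0 ≤ sPlus o R S + ε := by positivity
    generalize sPlus o R S + ε = α at *
    have hβ : 0 ≤ sPlus o S T + ε := by positivity
    generalize sPlus o S T + ε = β at *
    refine csInf_le (bddBelow_sPlus o R T) ⟨by positivity, β * a + a + b, by positivity, ?_⟩
    intro z hz
    obtain ⟨y, hy, hzy⟩ := mem_fatten.1 (hT hz)
    obtain ⟨x, hx, hyx⟩ := mem_fatten.1 (hS hy)
    refine mem_fatten.2 ⟨x, hx, ?_⟩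
    have h3 := dist_triangle z y x
    have h4 : dist o y ≤ dist o x + dist y x := by
      rw [dist_comm y x]; exact dist_triangle o x y
    have h5 : β * dist o y ≤ β * (dist o x + (α * dist o x + a)) :=
      mul_le_mul_of_nonneg_left (by linarith) hβ
    nlinarith
  have hlim : Tendsto (fun ε : ℝ => (sPlus o R S + ε) +
      (sPlus o R S + ε) * (sPlus o S T + ε) + (sPlus o S T + ε)) (𝓝[>] 0)
      (𝓝 (sPlus o R S + sPlus o R S * sPlus o S T + sPlus o S T)) := by
    have hc : Continuous (fun ε : ℝ => (sPlus o R S + ε) +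
      (sPlus o R S + ε) * (sPlus o S T + ε) + (sPlus o S T + ε)) := by fun_prop
    simpa using (hc.tendsto 0).mono_left nhdsWithin_le_nhds
  exact ge_of_tendsto hlim (by
    filter_upwards [self_mem_nhdsWithin] with ε hε using key ε hε)

theorem sDist_triangle (o : X) (R S T : Unbounded X) :
    sDist o R T ≤ sDist o R S + sDist o R S * sDist o S T + sDist o S T := by
  have hRS := sPlus_nonneg o R S
  have hSR := sPlus_nonneg o S R
  have hST := sPlus_nonneg o S T
  have hTS := sPlus_nonneg o T S
  have h1 : sPlus o R S ≤ sDist o R S := le_max_left _ _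
  have h2 : sPlus o S R ≤ sDist o R S := le_max_right _ _
  have h3 : sPlus o S T ≤ sDist o S T := le_max_left _ _
  have h4 : sPlus o T S ≤ sDist o S T := le_max_right _ _
  refine max_le ?_ ?_
  · have h5 := mul_le_mul h1 h3 hST (hRS.trans h1)
    linarith [sPlus_triangle o R S T]
  · have h5 := mul_le_mul h2 h4 hTS (hSR.trans h2)
    linarith [sPlus_triangle o T S R]

theorem sDist_self (o : X) (R : Unbounded X) : sDist o R R = 0 := by
  simp [sDist, sPlus_self]

theorem sDist_comm (o : X) (R S : Unbounded X) : sDist o R S = sDist o S R :=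
  max_comm _ _

theorem sDist_le_one (o : X) (R S : Unbounded X) : sDist o R S ≤ 1 := by
  have key : ∀ R S : Unbounded X, sPlus o R S ≤ 1 := by
    intro R S
    refine le_of_forall_pos_le_add fun ε hε => ?_
    refine csInf_le (bddBelow_sPlus o R S) ⟨by positivity, 0, le_rfl, fun y _ => ?_⟩
    rw [mem_fatten]
    by_contra hcon
    push Not at hcon
    refine R.2 ((Metric.isBounded_closedBall (x := o) (r := dist o y / ε)).subset fun x hx => ?_)
    have h1 := hcon x hx
    have h2 := dist_triangle y o x
    rw [Metric.mem_closedBall, dist_comm x o, le_div_iff₀ hε]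
    rw [dist_comm y o] at h2
    nlinarith
  exact max_le (key R S) (key S R)

theorem tDist_triangle (o : X) (R S T : Unbounded X) :
    tDist o R T ≤ tDist o R S + tDist o S T := by
  have h0 : 0 ≤ tDist o R S := Real.sqrt_nonneg _
  have h0' : 0 ≤ tDist o S T := Real.sqrt_nonneg _
  have h1 : tDist o R S ^ 2 = sDist o R S := Real.sq_sqrt (sDist_nonneg o R S)
  have h2 : tDist o S T ^ 2 = sDist o S T := Real.sq_sqrt (sDist_nonneg o S T)
  have h3 : tDist o R S ≤ 1 := Real.sqrt_le_one.2 (sDist_le_one o R S)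
  have h4 : tDist o S T ≤ 1 := Real.sqrt_le_one.2 (sDist_le_one o S T)
  refine Real.sqrt_le_iff.2 ⟨by positivity, (sDist_triangle o R S T).trans ?_⟩
  rw [← h1, ← h2]
  have h5 : tDist o R S * tDist o S T ≤ 1 := mul_le_one₀ h3 h0' h4
  nlinarith [mul_nonneg h0 h0']

theorem tDist_eq_zero {o : X} {R S : Unbounded X} : tDist o R S = 0 ↔ sDist o R S = 0 :=
  Real.sqrt_eq_zero (sDist_nonneg o R S)

theorem tDist_comm (o : X) (R S : Unbounded X) : tDist o R S = tDist o S R := by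
  rw [tDist, sDist_comm, tDist]

/-- Linear equivalence: `R ∼ S` if and only if `s(R,S) = 0`. -/
def linearEquiv (o : X) : Setoid (Unbounded X) where
  r R S := sDist o R S = 0
  iseqv :=
    { refl := sDist_self o
      symm := fun {R S} h => by rw [sDist_comm]; exact h
      trans := fun {R S T} h h' => by
        refine le_antisymm ?_ (sDist_nonneg o R T)
        simpa [h, h'] using sDist_triangle o R S T }

/-- The quotient `𝓤/∼` by linear equivalence. -/
def UnboundedQuot (o : X) : Type _ := Quotient (linearEquiv o)

/-- The class `[R]` in `𝓤/∼`. -/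
def cls (o : X) (R : Unbounded X) : UnboundedQuot o := Quotient.mk (linearEquiv o) R

theorem tDist_congr (o : X) (R S R' S' : Unbounded X) (h : sDist o R R' = 0)
    (h' : sDist o S S' = 0) : tDist o R S = tDist o R' S' := by
  have e := tDist_eq_zero.2 h
  have e' := tDist_eq_zero.2 h'
  have a1 := tDist_triangle o R R' S
  have a2 := tDist_triangle o R' S' S
  have a3 := tDist_triangle o R' R S'
  have a4 := tDist_triangle o R S S'
  have b1 := tDist_comm o R R'
  have b2 := tDist_comm o S S'
  linarith

/-- The metric `t` on `𝓤/∼`, given by `t([R],[S]) = t(R,S)`. -/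
instance (o : X) : MetricSpace (UnboundedQuot o) where
  dist := Quotient.lift₂ (s₁ := linearEquiv o) (s₂ := linearEquiv o) (tDist o) (tDist_congr o)
  dist_self := by
    rintro ⟨R⟩
    exact tDist_eq_zero.2 (sDist_self o R)
  dist_comm := by
    rintro ⟨R⟩ ⟨S⟩
    exact tDist_comm o R S
  dist_triangle := by
    rintro ⟨R⟩ ⟨S⟩ ⟨T⟩
    exact tDist_triangle o R S T
  eq_of_dist_eq_zero := by
    rintro ⟨R⟩ ⟨S⟩ h
    exact Quotient.sound (s := linearEquiv o) (tDist_eq_zero.1 h)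

theorem dist_cls (o : X) (R S : Unbounded X) : dist (cls o R) (cls o S) = tDist o R S := rfl

/-- `𝓔/∼`: the set of classes in `𝓤/∼` which contain an element of the family `𝓔 ⊆ 𝓤`. -/
def familyQuot (o : X) (E : Set (Unbounded X)) : Set (UnboundedQuot o) := cls o '' E

end Unbounded

/-! ### `CAT(0)` spaces -/

section CAT0

variable {X : Type*} [MetricSpace X]

/-- `γ` restricted to `[0, l]` is a geodesic (parametrized by arc length) from `p` to `q`. -/
structure IsGeodesic (γ : ℝ → X) (l : ℝ) (p q : X) : Prop where
  nonneg : 0 ≤ l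
  source : γ 0 = p
  target : γ l = q
  dist_eq : ∀ s ∈ Icc 0 l, ∀ t ∈ Icc 0 l, dist (γ s) (γ t) = |s - t|

/-- A `CAT(0)` space: a geodesic space in which distances between points on the sides of a geodesic
triangle are at most the distances of the comparison points in a Euclidean comparison triangle.
Two different sides of a triangle share a vertex, which is called `p` here; points on a common side
satisfy the inequality trivially. -/
structure IsCAT0 (X : Type*) [MetricSpace X] : Prop where
  exists_geodesic : ∀ p q : X, ∃ (γ : ℝ → X) (l : ℝ), IsGeodesic γ l p q
  comparison : ∀ (p q r : X) (γ σ : ℝ → X) (l m : ℝ), IsGeodesic γ l p q → IsGeodesic σ m p r →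
    ∀ p' q' r' : EuclideanSpace ℝ (Fin 2),
      dist p' q' = dist p q → dist p' r' = dist p r → dist q' r' = dist q r →
    ∀ s ∈ Icc 0 l, ∀ t ∈ Icc 0 m,
    ∀ x' ∈ segment ℝ p' q', ∀ y' ∈ segment ℝ p' r',
      dist p' x' = dist p (γ s) → dist p' y' = dist p (σ t) →
      dist (γ s) (σ t) ≤ dist x' y'

end CAT0

/-! ### Geodesic rays and the boundary at infinity -/

section Boundary

variable {X : Type*} [MetricSpace X]

/-- A geodesic ray: a map `c : [0,∞) → X` with `d(c(x),c(y)) = |x - y|`. -/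
structure GeodesicRay (X : Type*) [MetricSpace X] where
  toFun : ℝ≥0 → X
  dist_eq' : ∀ x y : ℝ≥0, dist (toFun x) (toFun y) = |(x : ℝ) - (y : ℝ)|

instance : CoeFun (GeodesicRay X) (fun _ => ℝ≥0 → X) := ⟨GeodesicRay.toFun⟩

/-- Two geodesic rays are asymptotic if they stay at bounded distance. -/
def asymptotic (X : Type*) [MetricSpace X] : Setoid (GeodesicRay X) where
  r c c' := ∃ K : ℝ, ∀ x : ℝ≥0, dist (c x) (c' x) ≤ K
  iseqv :=
    { refl := fun c => ⟨0, fun x => by simp⟩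
      symm := fun {c c'} ⟨K, h⟩ => ⟨K, fun x => by rw [dist_comm]; exact h x⟩
      trans := fun {c c' c''} ⟨K, h⟩ ⟨L, h'⟩ =>
        ⟨K + L, fun x => (dist_triangle _ (c' x) _).trans (add_le_add (h x) (h' x))⟩ }

/-- The boundary at infinity `∂X`. -/
def Boundary (X : Type*) [MetricSpace X] : Type _ := Quotient (asymptotic X)

/-- The boundary point represented by a geodesic ray. -/
def GeodesicRay.endpoint (c : GeodesicRay X) : Boundary X := Quotient.mk (asymptotic X) c

open Classical in
/-- The geodesic ray in the class `ξ` which emanates from `p`. In a complete `CAT(0)` space there is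
exactly one; if there is none, the value is some ray in `ξ`. -/
def rayFrom (p : X) (ξ : Boundary X) : GeodesicRay X :=
  if h : ∃ c : GeodesicRay X, c 0 = p ∧ c.endpoint = ξ then h.choose else Quotient.out ξ

/-- The angle at the vertex corresponding to `p` in a Euclidean comparison triangle for `p, x, y`
(where `x ≠ p ≠ y`), by the law of cosines. -/
def comparisonAngle (p x y : X) : ℝ :=
  Real.arccos ((dist p x ^ 2 + dist p y ^ 2 - dist x y ^ 2) / (2 * dist p x * dist p y))

/-- The (Alexandrov) angle between two geodesic rays `c, c'` emanating from the same point `p`: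
the upper limit of the comparison angles at `p` of `c(u), c'(v)` as `u, v → 0`, `u, v > 0`. -/
def rayAngle (c c' : GeodesicRay X) : ℝ :=
  limsup (fun w : ℝ≥0 × ℝ≥0 => comparisonAngle (c 0) (c w.1) (c' w.2)) (𝓝[>] 0 ×ˢ 𝓝[>] 0)

/-- `∠_p(ξ,ζ)`, the angle at `p` between the rays in `ξ` and `ζ` emanating from `p`. -/
def angleAt (p : X) (ξ ζ : Boundary X) : ℝ := rayAngle (rayFrom p ξ) (rayFrom p ζ)

/-- The angular metric `∠(ξ,ζ) = sup {∠_p(ξ,ζ) : p ∈ X}` on `∂X`. -/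
def angle (ξ ζ : Boundary X) : ℝ := ⨆ p : X, angleAt p ξ ζ

/-- The image `c([0,∞))` of a geodesic ray, as an unbounded subset of `X`. -/
def GeodesicRay.image (c : GeodesicRay X) : Unbounded X :=
  ⟨range c, fun hb => by
    obtain ⟨K, hK⟩ := Metric.isBounded_iff.1 hb
    have h1 := hK (mem_range_self (Real.toNNReal (|K| + 1))) (mem_range_self 0)
    rw [c.dist_eq', NNReal.coe_zero, sub_zero, Real.coe_toNNReal _ (by positivity),
      abs_of_nonneg (by positivity)] at h1
    linarith [le_abs_self K]⟩

/-- The family `𝓖` of the images of all geodesic rays in `X` (with arbitrary origins). -/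
def rayImages (X : Type*) [MetricSpace X] : Set (Unbounded X) :=
  {R | ∃ c : GeodesicRay X, R = c.image}

/-- The map `∂X → 𝓤/∼`, `ξ ↦ [R_ξ]`, where `R_ξ` is the image of the ray in `ξ` from `o`. -/
def boundaryMap (o : X) (ξ : Boundary X) : UnboundedQuot o := cls o (rayFrom o ξ).image

end Boundary

end AngleMetric

end

/-!
The boundary at infinity of a complete `CAT(0)` space and the linear geometry of its rays.

By the law of cosines, the `CAT(0)` comparison says that comparison angles grow with the sides
(`IsCAT0.law_of_cosines`). A ray from `p` asymptotic to a ray `c` is the limit of the geodesics from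
`p` to the points `c n` (`IsCAT0.exists_ray_from`), and it is unique because the distance of two
rays with a common origin is convex.

For rays `c`, `c'` with a common origin, the comparison angles of `c T`, `c' T` increase to a limit,
the asymptotic angle, with `2 sin (asymAngle c c' / 2) = growth c c' = lim d(c T, c' T) / T`. Since
the growth rate ignores bounded errors, this angle depends on the points at infinity only, and it
bounds the angles at all points of `X` from above. It is also their supremum: as `c M` lies on the
geodesic from `c 0` to any later point of `c`, the angle at `c M` is at least the comparison angle
of `c M`, `c' M` at the origin (`IsCAT0.cos_angleAt_le`). So the angular metric is the asymptotic
angle `θ` (`IsCAT0.angle_eq_asymAngle`).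

The linear distance `s` of two rays from `o` is compared with `θ` in the Euclidean model. A ray lies
in the cone of slope `sin θ` about the other if `θ < π / 2`, and `s ≤ 1` always, so `s ≤ θ`
(`IsCAT0.sDist_le_asymAngle`). Conversely, a cone of slope `α < 1` which contains the other ray, up
to a bounded error, has `sin θ ≤ α` and `θ ≤ π / 2`, so that `θ ≤ π s` by `2 φ / π ≤ sin φ`
(`IsCAT0.asymAngle_le_pi_mul_sDist`).

Finally `growth c c' ≤ θ ≤ π s`, so rays at distance `s = 0` coincide, and a sequence of rays from
`o` which is Cauchy for `t` converges pointwise. The limit is a ray, and it is the limit for `t`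
too, because `s ≤ growth`. Hence the image of the boundary is closed.
-/

open Set Filter Topology
open scoped NNReal

namespace AngleMetric

variable {X : Type*} [MetricSpace X]

/-! ### The law of cosines as an inequality -/

/-- A Euclidean triangle with prescribed sides `l`, `m` at the vertex `0` and opposite side `d`. The
distance between points on the two sides through `0` is given by the law of cosines. -/
theorem exists_comparison_triangle {l m d : ℝ} (hl : 0 < l) (hm : 0 < m) (hd : 0 ≤ d)
    (h1 : d ≤ l + m) (h2 : l ≤ m + d) (h3 : m ≤ l + d) :
    ∃ q r : EuclideanSpace ℝ (Fin 2), dist 0 q = l ∧ dist 0 r = m ∧ dist q r = d ∧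
      ∀ a b : ℝ, dist (a • q) (b • r) ^ 2 =
        (a * l) ^ 2 + (b * m) ^ 2 - a * b * (l ^ 2 + m ^ 2 - d ^ 2) := by
  set k := (l ^ 2 + m ^ 2 - d ^ 2) / (2 * l * m) with hk
  have hk' : 2 * l * m * k = l ^ 2 + m ^ 2 - d ^ 2 := by rw [hk]; field_simp
  have hlm : 0 < 2 * l * m := by positivity
  have hk1 : k ≤ 1 := by
    rw [hk, div_le_one hlm]
    nlinarith [mul_nonneg (show 0 ≤ d - (l - m) by linarith) (show 0 ≤ d + (l - m) by linarith)]
  have hk2 : -1 ≤ k := by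
    rw [hk, le_div_iff₀ hlm]
    nlinarith [mul_nonneg (show 0 ≤ l + m - d by linarith) (show 0 ≤ l + m + d by linarith)]
  have hs : Real.sqrt (1 - k ^ 2) ^ 2 = 1 - k ^ 2 := Real.sq_sqrt (by nlinarith)
  set w := Real.sqrt (1 - k ^ 2)
  have key : ∀ a b : ℝ, dist (a • (!₂[l, 0] : EuclideanSpace ℝ (Fin 2)))
      (b • (!₂[m * k, m * w] : EuclideanSpace ℝ (Fin 2))) ^ 2 =
        (a * l) ^ 2 + (b * m) ^ 2 - a * b * (l ^ 2 + m ^ 2 - d ^ 2) := by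
    intro a b
    rw [EuclideanSpace.dist_sq_eq, Fin.sum_univ_two, Real.dist_eq, Real.dist_eq, sq_abs, sq_abs,
      ← hk']
    simp only [PiLp.smul_apply, Matrix.cons_val_zero, Matrix.cons_val_one,
      smul_eq_mul]
    linear_combination b ^ 2 * m ^ 2 * hs
  refine ⟨!₂[l, 0], !₂[m * k, m * w], ?_, ?_, ?_, key⟩
  · have h := key 1 0
    rw [dist_comm, ← sq_eq_sq₀ dist_nonneg hl.le]
    simpa using h
  · have h := key 0 1
    rw [← sq_eq_sq₀ dist_nonneg hm.le]
    simpa using h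
  · have h := key 1 1
    rw [← sq_eq_sq₀ dist_nonneg hd]
    simp only [one_smul] at h
    rw [h]; ring

namespace IsGeodesic

variable {γ : ℝ → X} {l : ℝ} {p q : X}

theorem dist_source (h : IsGeodesic γ l p q) {s : ℝ} (hs : s ∈ Icc 0 l) : dist p (γ s) = s := by
  rw [← h.source, h.dist_eq 0 ⟨le_rfl, h.nonneg⟩ s hs, zero_sub, abs_neg, abs_of_nonneg hs.1]

theorem length (h : IsGeodesic γ l p q) : dist p q = l := by
  rw [← h.target, h.dist_source ⟨h.nonneg, le_rfl⟩]

theorem reverse (h : IsGeodesic γ l p q) : IsGeodesic (fun t => γ (l - t)) l q p where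
  nonneg := h.nonneg
  source := by simp [h.target]
  target := by simp [h.source]
  dist_eq s hs t ht := by
    rw [h.dist_eq _ ⟨by linarith [hs.2], by linarith [hs.1]⟩ _
      ⟨by linarith [ht.2], by linarith [ht.1]⟩, abs_sub_comm]
    congr 1
    ring

end IsGeodesic

/-- The `CAT(0)` inequality for points on two sides of a triangle, freed of the comparison triangle
by the law of cosines. It says that `(s² + t² - d(γ(s),σ(t))²) / (2st)` is at least its value at the
far ends of the two sides: comparison angles grow with the sides. -/
theorem IsCAT0.law_of_cosines (hX : IsCAT0 X) {γ σ : ℝ → X} {l m : ℝ} {p q r : X}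
    (hγ : IsGeodesic γ l p q) (hσ : IsGeodesic σ m p r) {s t : ℝ} (hs : s ∈ Icc 0 l)
    (ht : t ∈ Icc 0 m) :
    l * m * dist (γ s) (σ t) ^ 2 ≤
      l * m * (s ^ 2 + t ^ 2) - s * t * (l ^ 2 + m ^ 2 - dist q r ^ 2) := by
  rcases hγ.nonneg.eq_or_lt with rfl | hl
  · obtain rfl : s = 0 := le_antisymm hs.2 hs.1
    simp
  rcases hσ.nonneg.eq_or_lt with rfl | hm
  · obtain rfl : t = 0 := le_antisymm ht.2 ht.1
    simp
  have e1 := hγ.length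
  have e2 := hσ.length
  obtain ⟨q', r', hq, hr, hqr, h⟩ := exists_comparison_triangle (d := dist q r) hl hm dist_nonneg
    (by rw [← e1, ← e2, dist_comm p q]; exact dist_triangle q p r)
    (by rw [← e1, ← e2, dist_comm q r]; exact dist_triangle p r q)
    (by rw [← e1, ← e2]; exact dist_triangle p q r)
  have h1 := hX.comparison p q r γ σ l m hγ hσ 0 q' r' (by rw [hq, e1]) (by rw [hr, e2]) hqr
    s hs t ht ((s / l) • q')
    (by
      rw [segment_eq_image]
      exact ⟨s / l, ⟨by have := hs.1; positivity, (div_le_one hl).2 hs.2⟩, by simp⟩)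
    ((t / m) • r')
    (by
      rw [segment_eq_image]
      exact ⟨t / m, ⟨by have := ht.1; positivity, (div_le_one hm).2 ht.2⟩, by simp⟩)
    (by
      rw [hγ.dist_source hs, dist_zero_left, norm_smul, ← dist_zero_left q', hq, Real.norm_eq_abs,
        abs_of_nonneg (by have := hs.1; positivity)]
      field_simp)
    (by
      rw [hσ.dist_source ht, dist_zero_left, norm_smul, ← dist_zero_left r', hr, Real.norm_eq_abs,
        abs_of_nonneg (by have := ht.1; positivity)]
      field_simp)
  have h2 := pow_le_pow_left₀ dist_nonneg h1 2
  rw [h] at h2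
  calc l * m * dist (γ s) (σ t) ^ 2 ≤ l * m * _ :=
        mul_le_mul_of_nonneg_left h2 (by positivity)
    _ = _ := by field_simp

/-- The inequality of Bruhat and Tits: distance bound from a vertex `x` to a point on the opposite
side of a geodesic triangle. -/
theorem IsCAT0.bruhat_tits (hX : IsCAT0 X) {γ : ℝ → X} {l : ℝ} {p q : X}
    (hγ : IsGeodesic γ l p q) (x : X) {s : ℝ} (hs : s ∈ Icc 0 l) :
    l * dist (γ s) x ^ 2 ≤
      (l - s) * dist p x ^ 2 + s * dist q x ^ 2 - s * (l - s) * l := by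
  obtain ⟨σ, m, hσ⟩ := hX.exists_geodesic p x
  have e1 := hγ.length
  have e2 := hσ.length
  have h := hX.law_of_cosines hγ hσ hs ⟨hσ.nonneg, le_rfl⟩
  rw [hσ.target] at h
  rw [e2]
  rcases hσ.nonneg.eq_or_lt with rfl | hm
  · obtain rfl := dist_eq_zero.1 e2
    rw [dist_comm (γ s), hγ.dist_source hs, dist_comm q, e1]
    apply le_of_eq
    ring
  · refine le_of_mul_le_mul_left ?_ hm
    nlinarith

/-- Two geodesics with common origin and equal fractions of their lengths. -/
theorem IsCAT0.dist_mul_le (hX : IsCAT0 X) {γ σ : ℝ → X} {l m : ℝ} {p q r : X}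
    (hγ : IsGeodesic γ l p q) (hσ : IsGeodesic σ m p r) {a : ℝ} (ha : a ∈ Icc (0 : ℝ) 1) :
    dist (γ (a * l)) (σ (a * m)) ≤ a * dist q r := by
  have hs : a * l ∈ Icc 0 l := ⟨mul_nonneg ha.1 hγ.nonneg, mul_le_of_le_one_left hγ.nonneg ha.2⟩
  have ht : a * m ∈ Icc 0 m := ⟨mul_nonneg ha.1 hσ.nonneg, mul_le_of_le_one_left hσ.nonneg ha.2⟩
  rcases hγ.nonneg.eq_or_lt with rfl | hl
  · obtain rfl := dist_eq_zero.1 hγ.length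
    rw [mul_zero, hγ.source, hσ.dist_source ht, hσ.length]
  rcases hσ.nonneg.eq_or_lt with rfl | hm
  · obtain rfl := dist_eq_zero.1 hσ.length
    rw [mul_zero, hσ.source, dist_comm, hγ.dist_source hs, dist_comm, hγ.length]
  have h := hX.law_of_cosines hγ hσ hs ht
  refine le_of_sq_le_sq ?_ (mul_nonneg ha.1 dist_nonneg)
  refine le_of_mul_le_mul_left ?_ (mul_pos hl hm)
  linarith

/-! ### Geodesic rays from a common origin -/

namespace GeodesicRay

@[ext]
theorem ext {c c' : GeodesicRay X} (h : ∀ t, c t = c' t) : c = c' := by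
  cases c
  cases c'
  congr
  exact funext h

theorem dist_zero (c : GeodesicRay X) (t : ℝ≥0) : dist (c 0) (c t) = t := by
  rw [c.dist_eq', NNReal.coe_zero, zero_sub, abs_neg, NNReal.abs_eq]

theorem isGeodesic (c : GeodesicRay X) (T : ℝ≥0) :
    IsGeodesic (fun t => c t.toNNReal) T (c 0) (c T) where
  nonneg := T.2
  source := by simp
  target := by simp
  dist_eq s hs t ht := by
    rw [c.dist_eq', Real.coe_toNNReal _ hs.1, Real.coe_toNNReal _ ht.1]

/-- The part of a geodesic ray beyond a given parameter. -/
def shift (c : GeodesicRay X) (T : ℝ≥0) : GeodesicRay X where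
  toFun t := c (T + t)
  dist_eq' x y := by rw [c.dist_eq']; push_cast; congr 1; ring

theorem shift_apply (c : GeodesicRay X) (T t : ℝ≥0) : c.shift T t = c (T + t) := rfl

theorem endpoint_eq_iff {c c' : GeodesicRay X} :
    c.endpoint = c'.endpoint ↔ ∃ K : ℝ, ∀ x : ℝ≥0, dist (c x) (c' x) ≤ K :=
  Quotient.eq (r := asymptotic X)

theorem endpoint_shift (c : GeodesicRay X) (T : ℝ≥0) : (c.shift T).endpoint = c.endpoint :=
  endpoint_eq_iff.2 ⟨T, fun x => by rw [shift_apply, c.dist_eq']; simp⟩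

/-- A pointwise limit of maps that are eventually isometric on each pair of points is a geodesic
ray. -/
theorem exists_of_cauchySeq [CompleteSpace X] {u : ℕ → ℝ≥0 → X}
    (h : ∀ s t : ℝ≥0, ∀ᶠ n in atTop, dist (u n s) (u n t) = |(s : ℝ) - t|)
    (hu : ∀ s, CauchySeq fun n => u n s) :
    ∃ c : GeodesicRay X, ∀ s, Tendsto (fun n => u n s) atTop (𝓝 (c s)) := by
  choose f hf using fun s => cauchySeq_tendsto_of_complete (hu s)
  refine ⟨⟨f, fun s t => ?_⟩, hf⟩
  refine tendsto_nhds_unique ((hf s).dist (hf t)) (tendsto_const_nhds.congr' ?_)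
  filter_upwards [h s t] with n hn using hn.symm

end GeodesicRay

theorem IsCAT0.ray_law_of_cosines (hX : IsCAT0 X) {c c' : GeodesicRay X} (h : c 0 = c' 0) {s t S T : ℝ≥0}
    (hs : s ≤ S) (ht : t ≤ T) :
    (S * T : ℝ) * dist (c s) (c' t) ^ 2 ≤
      S * T * (s ^ 2 + t ^ 2) - s * t * (S ^ 2 + T ^ 2 - dist (c S) (c' T) ^ 2) := by
  have := hX.law_of_cosines (c.isGeodesic S) (h ▸ c'.isGeodesic T)
    (s := s) (t := t) ⟨s.2, hs⟩ ⟨t.2, ht⟩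
  simpa using this

theorem IsCAT0.ray_dist_mono (hX : IsCAT0 X) {c c' : GeodesicRay X} (h : c 0 = c' 0) {s T : ℝ≥0} (hs : s ≤ T) :
    T * dist (c s) (c' s) ≤ s * dist (c T) (c' T) := by
  have := hX.ray_law_of_cosines h hs hs
  refine le_of_sq_le_sq ?_ (by positivity)
  linarith

theorem IsCAT0.ray_unique (hX : IsCAT0 X) {c c' : GeodesicRay X} (h : c 0 = c' 0)
    (h' : c.endpoint = c'.endpoint) : c = c' := by
  obtain ⟨K, hK⟩ := GeodesicRay.endpoint_eq_iff.1 h'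
  ext t
  rw [← dist_le_zero]
  refine le_of_forall_pos_le_add fun ε hε => ?_
  have hK0 : 0 ≤ K := dist_nonneg.trans (hK 0)
  set T : ℝ≥0 := t + ⟨t * K / ε + 1, by positivity⟩ with hT
  have hT' : (T : ℝ) = t + (t * K / ε + 1) := by rw [hT]; rfl
  have h1 := hX.ray_dist_mono h (s := t) (T := T) (by rw [hT]; exact le_self_add)
  have h2 : (t : ℝ) * dist (c T) (c' T) ≤ t * K := mul_le_mul_of_nonneg_left (hK T) t.2
  have hT0 : (0 : ℝ) < T := by rw [hT']; positivity
  have h3 : t * K ≤ T * ε := by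
    rw [hT', add_mul, add_mul, div_mul_cancel₀ _ hε.ne']
    have : 0 ≤ (t : ℝ) * ε := by positivity
    linarith
  refine le_of_mul_le_mul_left ?_ hT0
  linarith

/-- Geodesics from `p` to the points of a ray `c` converge to a ray from `p` asymptotic to `c`. -/
theorem IsCAT0.exists_ray_from [CompleteSpace X] (hX : IsCAT0 X) (c : GeodesicRay X) (p : X) :
    ∃ (e : GeodesicRay X) (σ : ℕ → ℝ → X) (l : ℕ → ℝ), e 0 = p ∧ e.endpoint = c.endpoint ∧
      (∀ n : ℕ, IsGeodesic (σ n) (l n) p (c n)) ∧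
      ∀ r : ℝ≥0, Tendsto (fun n => σ n r) atTop (𝓝 (e r)) := by
  choose σ l hσ using fun n : ℕ => hX.exists_geodesic p (c n)
  set D := dist p (c 0) with hD
  have hD0 : 0 ≤ D := dist_nonneg
  have hl1 : ∀ n : ℕ, l n ≤ n + D := fun n => by
    have := dist_triangle p (c 0) (c n)
    rw [(hσ n).length, c.dist_zero] at this
    simpa [add_comm] using this
  have hl2 : ∀ n : ℕ, (n : ℝ) - D ≤ l n := fun n => by
    have := dist_triangle (c 0) p (c n)
    rw [(hσ n).length, c.dist_zero, dist_comm] at this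
    simp only [NNReal.coe_natCast] at this
    linarith
  have hcauchy : ∀ r : ℝ≥0, CauchySeq fun n => σ n r := by
    intro r
    rw [Metric.cauchySeq_iff']
    intro ε hε
    obtain ⟨N, hN⟩ := exists_nat_gt (2 * D + r + 8 * D * r ^ 2 / ε ^ 2)
    have hr : (0 : ℝ) ≤ r := r.2
    have hq : 0 ≤ 8 * D * r ^ 2 / ε ^ 2 := by positivity
    refine ⟨N, fun n hn => ?_⟩
    have hn' : (N : ℝ) ≤ n := by exact_mod_cast hn
    have a1 := hl2 n
    have a2 := hl1 n
    have b1 := hl2 N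
    have b2 := hl1 N
    have h1 := hX.law_of_cosines (hσ n) (hσ N) (s := r) (t := r) ⟨hr, by linarith⟩
      ⟨hr, by linarith⟩
    have h2 : dist (c n) (c N) = n - N := by
      rw [c.dist_eq', abs_of_nonneg (by simpa using hn')]
      simp
    have h3 : l n - l N ≤ n - N := by
      have := dist_triangle p (c N) (c n)
      rw [(hσ n).length, (hσ N).length, dist_comm (c N), h2] at this
      linarith
    rw [h2] at h1
    have h4 : ((n : ℝ) - N) ^ 2 - (l n - l N) ^ 2 ≤ 4 * D * n := by
      have h5 : ((n : ℝ) - N - (l n - l N)) * ((n : ℝ) - N + (l n - l N)) ≤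
          (2 * D) * (2 * n) := by
        refine (mul_le_mul_of_nonneg_left (b := ((n : ℝ) - N + (l n - l N)))
          (c := (2 * n : ℝ)) (by linarith) (by linarith)).trans ?_
        exact mul_le_mul_of_nonneg_right (by linarith) (by positivity)
      linarith
    have hln : (n : ℝ) ≤ 2 * l n := by linarith
    have hlN : 0 < l N := by linarith
    have hlnn : 0 < l n := by linarith
    have h6 : l N * dist (σ n r) (σ N r) ^ 2 ≤ 8 * D * r ^ 2 := by
      refine le_of_mul_le_mul_left ?_ hlnn
      calc l n * (l N * dist (σ n r) (σ N r) ^ 2)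
          ≤ r ^ 2 * (((n : ℝ) - N) ^ 2 - (l n - l N) ^ 2) := by linarith
        _ ≤ r ^ 2 * (4 * D * (2 * l n)) :=
          mul_le_mul_of_nonneg_left (h4.trans (mul_le_mul_of_nonneg_left hln (by positivity)))
            (by positivity)
        _ = _ := by ring
    have h7 : 8 * D * r ^ 2 < l N * ε ^ 2 := by
      rw [← div_lt_iff₀ (by positivity)]
      linarith
    exact lt_of_pow_lt_pow_left₀ 2 hε.le (lt_of_mul_lt_mul_left (h6.trans_lt h7) hlN.le)
  have hlarge : ∀ r : ℝ≥0, ∀ᶠ n : ℕ in atTop, (r : ℝ) + D < n := fun r =>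
    tendsto_natCast_atTop_atTop.eventually_gt_atTop _
  obtain ⟨e, he⟩ := GeodesicRay.exists_of_cauchySeq (u := fun n r => σ n r) (fun s t => by
    filter_upwards [hlarge s, hlarge t] with n hs ht
    exact (hσ n).dist_eq s ⟨s.2, by linarith [hl2 n]⟩ t ⟨t.2, by linarith [hl2 n]⟩) hcauchy
  refine ⟨e, σ, l, ?_, ?_, hσ, he⟩
  · refine tendsto_nhds_unique (he 0) (tendsto_const_nhds.congr fun n => ?_)
    exact (hσ n).source.symm
  · refine GeodesicRay.endpoint_eq_iff.2 ⟨2 * D, fun r => ?_⟩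
    refine le_of_tendsto ((he r).dist tendsto_const_nhds) ?_
    filter_upwards [hlarge r] with n hn
    have hr : (0 : ℝ) ≤ r := r.2
    have a1 := hl2 n
    have a2 := hl1 n
    have hln : 0 < l n := by linarith
    have hrl : (r : ℝ) / l n ≤ 1 := (div_le_one hln).2 (by linarith)
    have hrl0 : (0 : ℝ) ≤ r / l n := by positivity
    -- compare points dividing `[p, c n]` and `[c 0, c n]` in the same ratio
    have h1 := hX.dist_mul_le (hσ n).reverse (c.isGeodesic n).reverse (a := 1 - r / l n)
      ⟨by linarith, by linarith⟩
    have e1 : l n - (1 - r / l n) * l n = r := by field_simp; ring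
    have e2 : ((n : ℝ≥0) : ℝ) - (1 - r / l n) * ((n : ℝ≥0) : ℝ) = r / l n * n := by
      push_cast; ring
    simp only [e1, e2] at h1
    have h2 : dist (c (r / l n * n).toNNReal) (c r) ≤ D := by
      rw [c.dist_eq', Real.coe_toNNReal _ (by positivity)]
      have : (r : ℝ) / l n * n - r = r / l n * (n - l n) := by field_simp
      rw [this, abs_mul, abs_of_nonneg hrl0]
      refine (mul_le_of_le_one_left (abs_nonneg _) hrl).trans (abs_le.2 ⟨?_, ?_⟩) <;> linarith
    have h3 : (1 - r / l n) * D ≤ D := mul_le_of_le_one_left hD0 (by linarith)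
    have := dist_triangle (σ n r) (c (r / l n * n).toNNReal) (c r)
    linarith

theorem IsCAT0.existsUnique_ray [CompleteSpace X] (hX : IsCAT0 X) (p : X) (ξ : Boundary X) :
    ∃! c : GeodesicRay X, c 0 = p ∧ c.endpoint = ξ := by
  obtain ⟨c, rfl⟩ : ∃ c : GeodesicRay X, c.endpoint = ξ := Quotient.exists_rep ξ
  obtain ⟨e, -, -, he, he', -⟩ := hX.exists_ray_from c p
  exact ⟨e, ⟨he, he'⟩, fun e' h => hX.ray_unique (h.1.trans he.symm) (h.2.trans he'.symm)⟩

theorem IsCAT0.rayFrom_spec [CompleteSpace X] (hX : IsCAT0 X) (p : X) (ξ : Boundary X) :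
    rayFrom p ξ 0 = p ∧ (rayFrom p ξ).endpoint = ξ := by
  have h := (hX.existsUnique_ray p ξ).exists
  rw [rayFrom, dif_pos h]
  exact h.choose_spec

theorem IsCAT0.rayFrom_eq [CompleteSpace X] (hX : IsCAT0 X) {p : X} {ξ : Boundary X} {c : GeodesicRay X}
    (h : c 0 = p) (h' : c.endpoint = ξ) : rayFrom p ξ = c :=
  (hX.existsUnique_ray p ξ).unique (hX.rayFrom_spec p ξ) ⟨h, h'⟩

/-! ### The asymptotic angle of two rays from a common origin -/

/-- The growth rate of the distance between two geodesic rays. It is meant for rays with the same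
origin; the quotient is `0` at `T = 0`. In a `CAT(0)` space the quotient is monotone, and its
supremum is the limit for `T → ∞`. -/
noncomputable def growth (c c' : GeodesicRay X) : ℝ := ⨆ T : ℝ≥0, dist (c T) (c' T) / T

/-- The limit of the comparison angles of `c T`, `c' T` at the common origin of two rays, as
`T → ∞`: the apex angle of the isosceles triangle with legs `1` and base `growth c c'`. -/
noncomputable def asymAngle (c c' : GeodesicRay X) : ℝ := Real.arccos (1 - growth c c' ^ 2 / 2)

theorem dist_ray_le_two_mul {c c' : GeodesicRay X} (h : c 0 = c' 0) (T : ℝ≥0) :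
    dist (c T) (c' T) ≤ 2 * T := by
  have := dist_triangle_left (c T) (c' T) (c 0)
  rw [c.dist_zero, h, c'.dist_zero] at this
  linarith

theorem growth_nonneg (c c' : GeodesicRay X) : 0 ≤ growth c c' :=
  Real.iSup_nonneg fun _ => by positivity

theorem growth_comm (c c' : GeodesicRay X) : growth c c' = growth c' c := by
  simp only [growth, dist_comm]

theorem asymAngle_comm (c c' : GeodesicRay X) : asymAngle c c' = asymAngle c' c := by
  rw [asymAngle, growth_comm, asymAngle]

theorem growth_le_of_forall {c c' : GeodesicRay X} {a : ℝ} (ha : 0 ≤ a)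
    (h : ∀ T : ℝ≥0, dist (c T) (c' T) ≤ a * T) : growth c c' ≤ a :=
  Real.iSup_le (fun T => div_le_of_le_mul₀ T.2 ha (h T)) ha

theorem growth_le_two {c c' : GeodesicRay X} (h : c 0 = c' 0) : growth c c' ≤ 2 :=
  growth_le_of_forall zero_le_two (dist_ray_le_two_mul h)

theorem dist_le_growth_mul {c c' : GeodesicRay X} (h : c 0 = c' 0) (T : ℝ≥0) :
    dist (c T) (c' T) ≤ growth c c' * T := by
  rcases eq_zero_or_pos T with rfl | hT
  · simp [h]
  rw [← div_le_iff₀ (NNReal.coe_pos.2 hT)]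
  exact le_ciSup (f := fun T : ℝ≥0 => dist (c T) (c' T) / T)
    ⟨2, by rintro _ ⟨T, rfl⟩; exact div_le_of_le_mul₀ T.2 zero_le_two (dist_ray_le_two_mul h T)⟩ T

theorem cos_asymAngle {c c' : GeodesicRay X} (h : c 0 = c' 0) :
    Real.cos (asymAngle c c') = 1 - growth c c' ^ 2 / 2 := by
  have h1 := growth_nonneg c c'
  have h2 := growth_le_two h
  exact Real.cos_arccos (by nlinarith) (by nlinarith)

theorem asymAngle_nonneg (c c' : GeodesicRay X) : 0 ≤ asymAngle c c' := Real.arccos_nonneg _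

theorem asymAngle_le_pi (c c' : GeodesicRay X) : asymAngle c c' ≤ Real.pi := Real.arccos_le_pi _

theorem growth_le_asymAngle {c c' : GeodesicRay X} (h : c 0 = c' 0) :
    growth c c' ≤ asymAngle c c' := by
  refine le_of_sq_le_sq ?_ (asymAngle_nonneg c c')
  have := Real.one_sub_sq_div_two_le_cos (x := asymAngle c c')
  rw [cos_asymAngle h] at this
  linarith

theorem asymAngle_le_of_forall {c c' : GeodesicRay X} {θ : ℝ} (h0 : 0 ≤ θ)
    (hπ : θ ≤ Real.pi)
    (hθ : ∀ T : ℝ≥0, 0 < T → Real.cos θ ≤ 1 - (dist (c T) (c' T) / T) ^ 2 / 2) :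
    asymAngle c c' ≤ θ := by
  have h1 : growth c c' ≤ Real.sqrt (2 - 2 * Real.cos θ) := by
    refine Real.iSup_le (fun T => ?_) (Real.sqrt_nonneg _)
    rcases eq_zero_or_pos T with rfl | hT
    · simp
    · exact Real.le_sqrt_of_sq_le (by linarith [hθ T hT])
  have h2 := pow_le_pow_left₀ (growth_nonneg c c') h1 2
  rw [Real.sq_sqrt (by linarith [Real.cos_le_one θ])] at h2
  rw [asymAngle, ← Real.arccos_cos h0 hπ]
  exact Real.arccos_le_arccos (by linarith)

/-- The growth rate may be computed far out, and up to a bounded error. -/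
theorem IsCAT0.growth_le (hX : IsCAT0 X) {c c' : GeodesicRay X} (h : c 0 = c' 0) {a K : ℝ}
    (ha : 0 ≤ a) (hK : ∀ T : ℝ≥0, dist (c T) (c' T) ≤ a * T + K) : growth c c' ≤ a := by
  refine growth_le_of_forall ha fun t => ?_
  have hlim : Tendsto (fun n : ℕ => t * (a + K / ((n : ℝ) + 1))) atTop (𝓝 (t * (a + 0))) :=
    (tendsto_const_nhds.add ((tendsto_const_div_atTop_nhds_zero_nat K).comp
      (tendsto_add_atTop_nat 1) |>.congr fun n => by simp)).const_mul _
  rw [add_zero, mul_comm] at hlim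
  refine ge_of_tendsto hlim ?_
  filter_upwards [tendsto_natCast_atTop_atTop.eventually_ge_atTop (t : ℝ)] with n hn
  have hn1 : (0 : ℝ) < (n : ℝ) + 1 := by positivity
  have h1 := hX.ray_dist_mono h (s := t) (T := (n : ℝ≥0) + 1)
    (by rw [← NNReal.coe_le_coe]; push_cast; linarith)
  have h2 := mul_le_mul_of_nonneg_left (hK ((n : ℝ≥0) + 1)) t.2
  push_cast at h1 h2
  refine le_of_mul_le_mul_left ?_ hn1
  calc ((n : ℝ) + 1) * dist (c t) (c' t) ≤ t * (a * (n + 1) + K) := h1.trans h2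
    _ = _ := by field_simp

theorem IsCAT0.growth_le_of_endpoint_eq (hX : IsCAT0 X) {c c' e e' : GeodesicRay X}
    (h : c 0 = c' 0) (he : e 0 = e' 0) (h1 : c.endpoint = e.endpoint)
    (h2 : c'.endpoint = e'.endpoint) : growth c c' ≤ growth e e' := by
  obtain ⟨K, hK⟩ := GeodesicRay.endpoint_eq_iff.1 h1
  obtain ⟨K', hK'⟩ := GeodesicRay.endpoint_eq_iff.1 h2
  refine hX.growth_le h (K := K + K') (growth_nonneg _ _) fun T => ?_
  have := dist_triangle4 (c T) (e T) (e' T) (c' T)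
  rw [dist_comm (e' T)] at this
  linarith [hK T, hK' T, dist_le_growth_mul he T]

/-- The asymptotic angle depends on the points at infinity of the two rays only, not on their common
origin. -/
theorem IsCAT0.asymAngle_eq_of_endpoint_eq (hX : IsCAT0 X) {c c' e e' : GeodesicRay X}
    (h : c 0 = c' 0) (he : e 0 = e' 0) (h1 : c.endpoint = e.endpoint)
    (h2 : c'.endpoint = e'.endpoint) : asymAngle c c' = asymAngle e e' := by
  rw [asymAngle, asymAngle, le_antisymm (hX.growth_le_of_endpoint_eq h he h1 h2)
    (hX.growth_le_of_endpoint_eq he h h1.symm h2.symm)]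

theorem IsCAT0.dist_sq_le_asymAngle (hX : IsCAT0 X) {c c' : GeodesicRay X} (h : c 0 = c' 0)
    (s t : ℝ≥0) :
    dist (c s) (c' t) ^ 2 ≤ s ^ 2 + t ^ 2 - 2 * s * t * Real.cos (asymAngle c c') := by
  set T : ℝ≥0 := max s t + 1 with hT
  have hT0 : (0 : ℝ) < T := by rw [hT]; positivity
  have h1 := hX.ray_law_of_cosines h (s := s) (t := t) (S := T) (T := T)
    (le_trans (le_max_left s t) le_self_add) (le_trans (le_max_right s t) le_self_add)
  have h2 := pow_le_pow_left₀ dist_nonneg (dist_le_growth_mul h T) 2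
  have h3 := mul_le_mul_of_nonneg_left h2 (mul_nonneg s.2 t.2)
  rw [cos_asymAngle h]
  refine le_of_mul_le_mul_left ?_ (mul_pos hT0 hT0)
  simp only [NNReal.val_eq_coe] at h3
  linarith

/-- A comparison triangle cut off a larger one, spanned by two rays, has the smaller angle. -/
theorem IsCAT0.le_dist_sq_of_le (hX : IsCAT0 X) {c c' : GeodesicRay X} (h : c 0 = c' 0)
    {M s t : ℝ≥0} (hM : 0 < M) (hs : M ≤ s) (ht : M ≤ t) :
    s ^ 2 + t ^ 2 - 2 * s * t * (1 - (dist (c M) (c' M) / M) ^ 2 / 2) ≤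
      dist (c s) (c' t) ^ 2 := by
  have h1 := hX.ray_law_of_cosines h hs ht
  have hM' : (0 : ℝ) < M := hM
  refine le_of_mul_le_mul_left ?_ (mul_pos hM' hM')
  have h2 : (dist (c M) (c' M) / M) ^ 2 * (M * M) = dist (c M) (c' M) ^ 2 := by field_simp
  linear_combination h1 + s * t * h2

/-! ### The angular metric as an asymptotic angle -/

theorem rayAngle_le_of_forall {c c' : GeodesicRay X} {θ : ℝ}
    (hθ : ∀ s t : ℝ≥0, 0 < s → 0 < t → comparisonAngle (c 0) (c s) (c' t) ≤ θ) :
    rayAngle c c' ≤ θ := by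
  refine limsup_le_of_le ⟨0, fun a ha => ?_⟩ ?_
  · obtain ⟨w, hw⟩ := (eventually_map.1 ha).exists
    exact (Real.arccos_nonneg _).trans hw
  · filter_upwards [prod_mem_prod (self_mem_nhdsWithin (s := Ioi (0 : ℝ≥0)))
      (self_mem_nhdsWithin (s := Ioi (0 : ℝ≥0)))] with w hw
    exact hθ _ _ hw.1 hw.2

theorem le_rayAngle_of_forall {c c' : GeodesicRay X} {θ : ℝ}
    (hθ : ∀ s t : ℝ≥0, 0 < s → 0 < t → θ ≤ comparisonAngle (c 0) (c s) (c' t)) :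
    θ ≤ rayAngle c c' := by
  refine le_limsup_of_frequently_le (Eventually.frequently ?_)
    ⟨Real.pi, eventually_map.2 (Eventually.of_forall fun w => Real.arccos_le_pi _)⟩
  filter_upwards [prod_mem_prod (self_mem_nhdsWithin (s := Ioi (0 : ℝ≥0)))
    (self_mem_nhdsWithin (s := Ioi (0 : ℝ≥0)))] with w hw
  exact hθ _ _ hw.1 hw.2

theorem rayAngle_nonneg (c c' : GeodesicRay X) : 0 ≤ rayAngle c c' :=
  le_rayAngle_of_forall fun _ _ _ _ => Real.arccos_nonneg _

theorem rayAngle_le_pi (c c' : GeodesicRay X) : rayAngle c c' ≤ Real.pi :=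
  rayAngle_le_of_forall fun _ _ _ _ => Real.arccos_le_pi _

theorem comparisonAngle_rays {c c' : GeodesicRay X} (h : c 0 = c' 0) (s t : ℝ≥0) :
    comparisonAngle (c 0) (c s) (c' t) =
      Real.arccos ((s ^ 2 + t ^ 2 - dist (c s) (c' t) ^ 2) / (2 * s * t)) := by
  have h' := c'.dist_zero t
  rw [← h] at h'
  rw [comparisonAngle, c.dist_zero, h']

theorem IsCAT0.rayAngle_le_asymAngle (hX : IsCAT0 X) {c c' : GeodesicRay X} (h : c 0 = c' 0) :
    rayAngle c c' ≤ asymAngle c c' := by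
  refine rayAngle_le_of_forall fun s t hs ht => ?_
  have hs' : (0 : ℝ) < s := hs
  have ht' : (0 : ℝ) < t := ht
  rw [comparisonAngle_rays h, ← Real.arccos_cos (asymAngle_nonneg c c') (asymAngle_le_pi c c')]
  refine Real.arccos_le_arccos ?_
  rw [le_div_iff₀ (by positivity)]
  linarith [hX.dist_sq_le_asymAngle h s t]

/-- Let the ray `e` from `c M` be the limit of geodesics from `c M` to points of the ray `c'`. The
comparison angle at `c M` of `c 0` and a point of `e` is at most the supplement of the comparison
angle at `c 0` of `c M` and `c' M`. -/
theorem IsCAT0.dist_sq_le_of_tendsto (hX : IsCAT0 X) {c c' e : GeodesicRay X} (h : c 0 = c' 0)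
    {M : ℝ≥0} (hM : 0 < M) {σ : ℕ → ℝ → X} {l : ℕ → ℝ}
    (hσ : ∀ n : ℕ, IsGeodesic (σ n) (l n) (c M) (c' n))
    (he : ∀ r : ℝ≥0, Tendsto (fun n => σ n r) atTop (𝓝 (e r))) (r : ℝ≥0) :
    dist (c 0) (e r) ^ 2 ≤
      M ^ 2 + r ^ 2 + 2 * M * r * (1 - (dist (c M) (c' M) / M) ^ 2 / 2) := by
  set k := 1 - (dist (c M) (c' M) / M) ^ 2 / 2 with hk
  have hM' : (0 : ℝ) < M := hM
  have hl1 : ∀ n : ℕ, l n ≤ n + M := fun n => by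
    have := dist_triangle (c M) (c 0) (c' n)
    rw [(hσ n).length, dist_comm, c.dist_zero, h, c'.dist_zero] at this
    simpa [add_comm] using this
  have hl2 : ∀ n : ℕ, (n : ℝ) - M ≤ l n := fun n => by
    have := dist_triangle (c 0) (c M) (c' n)
    rw [(hσ n).length, c.dist_zero, h, c'.dist_zero] at this
    simp only [NNReal.coe_natCast] at this
    linarith
  have hMn : Tendsto (fun n : ℕ => (M : ℝ) / n) atTop (𝓝 0) := tendsto_const_div_atTop_nhds_zero_nat _
  have hln : Tendsto (fun n : ℕ => l n / n) atTop (𝓝 1) := by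
    have h1 := (tendsto_const_nhds (x := (1 : ℝ))).sub hMn
    have h2 := (tendsto_const_nhds (x := (1 : ℝ))).add hMn
    rw [sub_zero] at h1
    rw [add_zero] at h2
    refine tendsto_of_tendsto_of_tendsto_of_le_of_le' h1 h2 ?_ ?_
    all_goals
      filter_upwards [eventually_gt_atTop 0] with n hn
      have hn' : (0 : ℝ) < n := by exact_mod_cast hn
    · rw [le_div_iff₀ hn', sub_mul, div_mul_cancel₀ _ hn'.ne', one_mul]
      exact hl2 n
    · rw [div_le_iff₀ hn', add_mul, div_mul_cancel₀ _ hn'.ne', one_mul]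
      exact hl1 n
  have hL : Tendsto (fun n : ℕ => l n / n * (dist (c 0) (σ n r) ^ 2 - M ^ 2 - r ^ 2)) atTop
      (𝓝 (1 * (dist (c 0) (e r) ^ 2 - M ^ 2 - r ^ 2))) :=
    hln.mul (((((tendsto_const_nhds.dist (he r)).pow 2).sub_const _).sub_const _))
  have hR : Tendsto (fun n : ℕ => 2 * M * r * (k - M / n)) atTop (𝓝 (2 * M * r * (k - 0))) :=
    (tendsto_const_nhds.sub hMn).const_mul _
  have key := le_of_tendsto_of_tendsto hL hR (by
    filter_upwards [tendsto_natCast_atTop_atTop.eventually_gt_atTop ((M : ℝ) + r + M)] with n hn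
    have hr : (0 : ℝ) ≤ r := r.2
    have hn' : (0 : ℝ) < n := by linarith
    have a1 := hl2 n
    have h1 := hX.law_of_cosines (c.isGeodesic M).reverse (hσ n) (s := M) (t := r)
      ⟨M.2, le_rfl⟩ ⟨hr, by linarith⟩
    simp only [sub_self, Real.toNNReal_zero] at h1
    rw [h, c'.dist_zero, ← h] at h1
    have h2 := hX.le_dist_sq_of_le h hM le_rfl (t := n) (by
      rw [← NNReal.coe_le_coe]; push_cast; linarith)
    rw [(hσ n).length] at h2
    push_cast at h1 h2
    rw [← hk] at h2
    have h3 : l n * (dist (c 0) (σ n r) ^ 2 - M ^ 2 - r ^ 2) ≤ 2 * M * r * (k * n - M) := by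
      have h4 := mul_le_mul_of_nonneg_left h2 hr
      refine le_of_mul_le_mul_left ?_ hM'
      nlinarith
    rw [div_mul_eq_mul_div, div_le_iff₀ hn']
    refine h3.trans (le_of_eq ?_)
    field_simp)
  linarith

/-- The main estimate for the angular metric: seen from a point `c M` far out on the first ray, the
angle between the points at infinity of two rays is at least the comparison angle of `c M`, `c' M`
at the origin. The reason is that `c M` lies on the geodesic from `c 0` to any later point of
`c`. -/
theorem IsCAT0.cos_angleAt_le [CompleteSpace X] (hX : IsCAT0 X) {c c' : GeodesicRay X}
    (h : c 0 = c' 0) {M : ℝ≥0} (hM : 0 < M) :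
    Real.cos (angleAt (c M) c.endpoint c'.endpoint) ≤
      1 - (dist (c M) (c' M) / M) ^ 2 / 2 := by
  set k := 1 - (dist (c M) (c' M) / M) ^ 2 / 2 with hk
  have hM' : (0 : ℝ) < M := hM
  obtain ⟨e, σ, l, he0, hee, hσ, he⟩ := hX.exists_ray_from c' (c M)
  have hs0 : c.shift M 0 = c M := by rw [GeodesicRay.shift_apply, add_zero]
  rw [angleAt, hX.rayFrom_eq hs0 (c.endpoint_shift M), hX.rayFrom_eq he0 hee]
  have hk1 : k ≤ 1 := by rw [hk]; linarith [sq_nonneg (dist (c M) (c' M) / M)]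
  have hk2 : -1 ≤ k := by
    have h1 : dist (c M) (c' M) / M ≤ 2 := (div_le_iff₀ hM').2 (dist_ray_le_two_mul h M)
    have h2 : 0 ≤ dist (c M) (c' M) / M := by positivity
    rw [hk]
    nlinarith
  rw [← Real.cos_arccos hk2 hk1]
  refine Real.cos_le_cos_of_nonneg_of_le_pi (Real.arccos_nonneg _) (rayAngle_le_pi _ _) ?_
  refine le_rayAngle_of_forall fun s r hs hr => ?_
  rw [comparisonAngle_rays (hs0.trans he0.symm)]
  refine Real.arccos_le_arccos ?_
  have hs' : (0 : ℝ) < s := hs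
  have hr' : (0 : ℝ) < r := hr
  rw [div_le_iff₀ (by positivity), GeodesicRay.shift_apply]
  have h1 := hX.bruhat_tits (c.isGeodesic (M + s)) (e r) (s := M) ⟨M.2, by simp⟩
  have h2 := hX.dist_sq_le_of_tendsto h hM hσ he r
  rw [← hk] at h2
  have h3 := e.dist_zero r
  rw [he0] at h3
  simp only [Real.toNNReal_coe, h3, NNReal.coe_add] at h1
  have h4 := mul_le_mul_of_nonneg_left h2 hs'.le
  refine le_of_mul_le_mul_left ?_ hM'
  linarith

theorem bddAbove_angleAt (ξ ζ : Boundary X) : BddAbove (range fun p => angleAt p ξ ζ) :=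
  ⟨Real.pi, by rintro _ ⟨p, rfl⟩; exact rayAngle_le_pi _ _⟩

theorem angleAt_le_angle (p : X) (ξ ζ : Boundary X) : angleAt p ξ ζ ≤ angle ξ ζ :=
  le_ciSup (bddAbove_angleAt ξ ζ) p

/-- The angular metric is the asymptotic angle of the rays from any given point. -/
theorem IsCAT0.angle_eq_asymAngle [CompleteSpace X] (hX : IsCAT0 X) {c c' : GeodesicRay X}
    (h : c 0 = c' 0) : angle c.endpoint c'.endpoint = asymAngle c c' := by
  have : Nonempty X := ⟨c 0⟩
  refine le_antisymm (ciSup_le fun p => ?_) ?_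
  · obtain ⟨h1, h2⟩ := hX.rayFrom_spec p c.endpoint
    obtain ⟨h1', h2'⟩ := hX.rayFrom_spec p c'.endpoint
    rw [angleAt, ← hX.asymAngle_eq_of_endpoint_eq (h1.trans h1'.symm) h h2 h2']
    exact hX.rayAngle_le_asymAngle (h1.trans h1'.symm)
  · have h0 : ∀ p, 0 ≤ angleAt p c.endpoint c'.endpoint := fun p => rayAngle_nonneg _ _
    have hπ : angle c.endpoint c'.endpoint ≤ Real.pi := ciSup_le fun p => rayAngle_le_pi _ _
    refine asymAngle_le_of_forall ((h0 (c 0)).trans (angleAt_le_angle _ _ _)) hπ fun M hM => ?_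
    refine le_trans ?_ (hX.cos_angleAt_le h hM)
    exact Real.cos_le_cos_of_nonneg_of_le_pi (h0 _) hπ (angleAt_le_angle _ _ _)

/-! ### Linear distance of rays -/

theorem sPlus_le_of_forall {o : X} {c c' : GeodesicRay X} {α a : ℝ} (hα : 0 ≤ α)
    (ha : 0 ≤ a) (h : ∀ t, ∃ t', dist (c' t) (c t') ≤ α * dist o (c t') + a) :
    sPlus o c.image c'.image ≤ α := by
  refine csInf_le (bddBelow_sPlus _ _ _) ⟨hα, a, ha, ?_⟩
  rintro _ ⟨t, rfl⟩
  obtain ⟨t', ht'⟩ := h t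
  exact mem_fatten.2 ⟨_, mem_range_self t', ht'⟩

theorem sDist_le_growth {c c' : GeodesicRay X} (h : c 0 = c' 0) :
    sDist (c 0) c.image c'.image ≤ growth c c' := by
  have key : ∀ {c c' : GeodesicRay X}, c 0 = c' 0 →
      sPlus (c 0) c.image c'.image ≤ growth c c' := by
    intro c c' h
    refine sPlus_le_of_forall (growth_nonneg c c') le_rfl fun t => ⟨t, ?_⟩
    rw [dist_comm, c.dist_zero, add_zero]
    exact dist_le_growth_mul h t
  refine max_le (key h) ?_
  rw [growth_comm, h]
  exact key h.symm

theorem sDist_eq_zero_of_endpoint_eq (o : X) {c c' : GeodesicRay X}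
    (h : c.endpoint = c'.endpoint) : sDist o c.image c'.image = 0 := by
  have key : ∀ {c c' : GeodesicRay X}, c.endpoint = c'.endpoint →
      sPlus o c.image c'.image ≤ 0 := by
    intro c c' h
    obtain ⟨K, hK⟩ := GeodesicRay.endpoint_eq_iff.1 h
    refine sPlus_le_of_forall le_rfl (dist_nonneg.trans (hK 0)) fun t => ⟨t, ?_⟩
    rw [dist_comm, zero_mul, zero_add]
    exact hK t
  exact le_antisymm (max_le (key h) (key h.symm)) (sDist_nonneg _ _ _)

theorem IsCAT0.sDist_le_asymAngle (hX : IsCAT0 X) {c c' : GeodesicRay X} (h : c 0 = c' 0) :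
    sDist (c 0) c.image c'.image ≤ asymAngle c c' := by
  have key : ∀ {c c' : GeodesicRay X}, c 0 = c' 0 → asymAngle c c' < Real.pi / 2 →
      sPlus (c 0) c.image c'.image ≤ asymAngle c c' := by
    intro c c' h hθ
    have h0 := asymAngle_nonneg c c'
    have hk : 0 < Real.cos (asymAngle c c') :=
      Real.cos_pos_of_mem_Ioo ⟨by linarith [Real.pi_pos], hθ⟩
    have hsin : 0 ≤ Real.sin (asymAngle c c') :=
      Real.sin_nonneg_of_nonneg_of_le_pi h0 (asymAngle_le_pi c c')
    refine (sPlus_le_of_forall hsin le_rfl fun t => ?_).trans (Real.sin_le h0)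
    -- in the Euclidean plane, the disc about the point at distance `t / cos θ` from the apex is
    -- tangent to the other leg at distance `t`
    obtain ⟨t', ht'⟩ : ∃ t' : ℝ≥0, (t' : ℝ) = t / Real.cos (asymAngle c c') :=
      ⟨⟨_, by positivity⟩, rfl⟩
    refine ⟨t', ?_⟩
    have e : (t : ℝ) = Real.cos (asymAngle c c') * t' := by
      rw [ht']; field_simp
    rw [c.dist_zero, add_zero, dist_comm]
    refine le_of_sq_le_sq ((hX.dist_sq_le_asymAngle h t' t).trans (le_of_eq ?_))
      (mul_nonneg hsin t'.2)
    rw [e]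
    linear_combination (-(t' : ℝ) ^ 2) * Real.sin_sq_add_cos_sq (asymAngle c c')
  rcases lt_or_ge (asymAngle c c') (Real.pi / 2) with hθ | hθ
  · refine max_le (key h hθ) ?_
    rw [asymAngle_comm] at hθ ⊢
    rw [h]
    exact key h.symm hθ
  · exact (sDist_le_one _ _ _).trans (by linarith [Real.pi_gt_three])

/-- A cone of slope `α` about the first ray that contains the second ray has an apex angle at least
`θ`, or reaches a right angle, for every comparison angle `θ` of the two rays. -/
theorem IsCAT0.one_sub_sq_le_of_subset_fatten (hX : IsCAT0 X) {c c' : GeodesicRay X}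
    (h : c 0 = c' 0) {α a : ℝ} (hα : 0 ≤ α) (ha : 0 ≤ a)
    (hsub : c'.image.1 ⊆ fatten (c 0) α c.image.1 a) {M : ℝ≥0} (hM : 0 < M) :
    1 - (max (1 - (dist (c M) (c' M) / M) ^ 2 / 2) 0) ^ 2 ≤ α ^ 2 := by
  by_contra! hcon
  set k := 1 - (dist (c M) (c' M) / M) ^ 2 / 2 with hk
  set δ := 1 - (max k 0) ^ 2 - α ^ 2 with hδ
  have hδ0 : 0 < δ := by rw [hδ]; linarith
  have hα1 : α ≤ 1 := by nlinarith [sq_nonneg (max k 0)]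
  have hM' : (0 : ℝ) < M := hM
  have hq : 0 ≤ 3 * a / δ := by positivity
  set t : ℝ≥0 := ⟨2 * (M + a + 3 * a / δ + 1) + a, by positivity⟩ with ht
  have ht' : (t : ℝ) = 2 * (M + a + 3 * a / δ + 1) + a := rfl
  obtain ⟨_, ⟨u, rfl⟩, hu⟩ := mem_fatten.1 (hsub (mem_range_self t))
  rw [c.dist_zero] at hu
  have hu0 : (0 : ℝ) ≤ u := u.2
  -- the point of the first ray is far out as well
  have h1 : (t : ℝ) ≤ u + (α * u + a) := by
    have := dist_triangle (c 0) (c u) (c' t)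
    rw [c.dist_zero, h, c'.dist_zero, dist_comm] at this
    linarith
  have h2 : (M : ℝ) + a + 3 * a / δ + 1 ≤ u := by
    have := mul_le_of_le_one_left hu0 hα1
    linarith
  have h3 := hX.le_dist_sq_of_le h hM (s := u) (t := t)
    (by rw [← NNReal.coe_le_coe]; linarith) (by rw [← NNReal.coe_le_coe]; linarith)
  rw [← hk] at h3
  have h4 : dist (c u) (c' t) ^ 2 ≤ (α * u + a) ^ 2 :=
    pow_le_pow_left₀ dist_nonneg (by rw [dist_comm]; exact hu) 2
  have h5 : (u : ℝ) * t * k ≤ u * t * max k 0 :=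
    mul_le_mul_of_nonneg_left (le_max_left _ _) (by positivity)
  have h6 : δ * u ^ 2 ≤ 2 * α * u * a + a ^ 2 := by
    rw [hδ]
    nlinarith [sq_nonneg (t - u * max k 0)]
  have h7 : 3 * a < δ * u := by
    rw [← div_lt_iff₀' hδ0]
    linarith
  have h8 : α * (u * a) ≤ u * a := mul_le_of_le_one_left (by positivity) hα1
  nlinarith

theorem IsCAT0.asymAngle_le_pi_mul_sDist (hX : IsCAT0 X) {c c' : GeodesicRay X}
    (h : c 0 = c' 0) : asymAngle c c' ≤ Real.pi * sDist (c 0) c.image c'.image := by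
  have hπ := Real.pi_pos
  refine asymAngle_le_of_forall (mul_nonneg hπ.le (sDist_nonneg _ _ _))
    (mul_le_of_le_one_right hπ.le (sDist_le_one _ _ _)) fun M hM => ?_
  set k := 1 - (dist (c M) (c' M) / M) ^ 2 / 2 with hk
  have hM' : (0 : ℝ) < M := hM
  have hk1 : k ≤ 1 := by rw [hk]; linarith [sq_nonneg (dist (c M) (c' M) / M)]
  have hk2 : -1 ≤ k := by
    have h1 : dist (c M) (c' M) / M ≤ 2 := (div_le_iff₀ hM').2 (dist_ray_le_two_mul h M)
    have h2 : 0 ≤ dist (c M) (c' M) / M := by positivity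
    rw [hk]
    nlinarith
  have key : Real.arccos k / Real.pi ≤ sPlus (c 0) c.image c'.image := by
    refine le_csInf (nonempty_sPlus _ _ _) ?_
    rintro α ⟨hα, a, ha, hsub⟩
    have h1 := hX.one_sub_sq_le_of_subset_fatten h hα ha hsub hM
    rw [← hk] at h1
    rw [div_le_iff₀ hπ]
    set φ := Real.arccos (max k 0) with hφ
    have hφ0 : 0 ≤ φ := Real.arccos_nonneg _
    have hφ1 : φ ≤ Real.pi / 2 := Real.arccos_le_pi_div_two.2 (le_max_right _ _)
    have h2 : Real.sin φ ≤ α := by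
      rw [hφ, Real.sin_arccos]
      exact Real.sqrt_le_iff.2 ⟨hα, h1⟩
    have h3 := Real.mul_le_sin hφ0 hφ1
    have h4 : 2 * φ ≤ α * Real.pi := by
      have h5 := mul_le_mul_of_nonneg_right (h3.trans h2) hπ.le
      have h6 : 2 / Real.pi * φ * Real.pi = 2 * φ := by field_simp
      linarith
    rcases le_total 0 k with hk0 | hk0
    · rw [hφ, max_eq_left hk0] at h4 hφ0
      linarith
    · rw [hφ, max_eq_right hk0, Real.arccos_zero] at h4
      linarith [Real.arccos_le_pi k]
  have h1 : Real.arccos k ≤ Real.pi * sDist (c 0) c.image c'.image := by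
    rw [div_le_iff₀' hπ] at key
    exact key.trans (mul_le_mul_of_nonneg_left (le_max_left _ _) hπ.le)
  rw [← Real.cos_arccos hk2 hk1]
  exact Real.cos_le_cos_of_nonneg_of_le_pi (Real.arccos_nonneg _)
    (mul_le_of_le_one_right hπ.le (sDist_le_one _ _ _)) h1

/-! ### The boundary map -/

theorem sq_dist_cls (o : X) (R S : Unbounded X) :
    dist (cls o R) (cls o S) ^ 2 = sDist o R S := by
  rw [dist_cls, tDist, Real.sq_sqrt (sDist_nonneg o R S)]

theorem cls_image_eq_boundaryMap [CompleteSpace X] (hX : IsCAT0 X) (o : X) (c : GeodesicRay X) :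
    cls o c.image = boundaryMap o c.endpoint := by
  refine dist_eq_zero.1 (tDist_eq_zero.2 (sDist_eq_zero_of_endpoint_eq o ?_))
  exact (hX.rayFrom_spec o c.endpoint).2.symm

theorem familyQuot_rayImages [CompleteSpace X] (hX : IsCAT0 X) (o : X) :
    familyQuot o (rayImages X) = range (boundaryMap o) := by
  ext x
  constructor
  · rintro ⟨_, ⟨c, rfl⟩, rfl⟩
    exact ⟨c.endpoint, (cls_image_eq_boundaryMap hX o c).symm⟩
  · rintro ⟨ξ, rfl⟩
    exact ⟨_, ⟨rayFrom o ξ, rfl⟩, rfl⟩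

theorem growth_le_pi_mul_dist_sq [CompleteSpace X] (hX : IsCAT0 X) (o : X) (ξ ζ : Boundary X) :
    growth (rayFrom o ξ) (rayFrom o ζ) ≤
      Real.pi * dist (boundaryMap o ξ) (boundaryMap o ζ) ^ 2 := by
  have h1 := (hX.rayFrom_spec o ξ).1
  have h := h1.trans (hX.rayFrom_spec o ζ).1.symm
  refine (growth_le_asymAngle h).trans ((hX.asymAngle_le_pi_mul_sDist h).trans ?_)
  rw [h1, boundaryMap, boundaryMap, sq_dist_cls]

theorem injective_boundaryMap [CompleteSpace X] (hX : IsCAT0 X) (o : X) :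
    Function.Injective (boundaryMap o) := by
  intro ξ ζ hξζ
  obtain ⟨h1, h2⟩ := hX.rayFrom_spec o ξ
  obtain ⟨h1', h2'⟩ := hX.rayFrom_spec o ζ
  have hg := growth_le_pi_mul_dist_sq hX o ξ ζ
  rw [hξζ, dist_self, zero_pow two_ne_zero, mul_zero] at hg
  rw [← h2, ← h2']
  congr 1
  ext t
  refine dist_le_zero.1 ((dist_le_growth_mul (h1.trans h1'.symm) t).trans ?_)
  exact mul_nonpos_of_nonpos_of_nonneg hg t.2

/-- A Cauchy sequence of boundary points has representing rays from `o` which converge pointwise;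
the limit ray represents the limit, because the distance of rays is controlled linearly. -/
theorem isClosed_range_boundaryMap [CompleteSpace X] (hX : IsCAT0 X) (o : X) :
    IsClosed (range (boundaryMap o)) := by
  refine isSeqClosed_iff_isClosed.1 fun x S hx hS => ?_
  choose ξ hξ using hx
  obtain rfl : (fun n => boundaryMap o (ξ n)) = x := funext hξ
  set c : ℕ → GeodesicRay X := fun n => rayFrom o (ξ n) with hc
  have hc0 : ∀ n, c n 0 = o := fun n => (hX.rayFrom_spec o (ξ n)).1
  have hgrowth : ∀ ε > 0, ∃ N, ∀ m ≥ N, ∀ n ≥ N, growth (c m) (c n) ≤ ε := by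
    intro ε hε
    obtain ⟨N, hN⟩ := Metric.cauchySeq_iff.1 hS.cauchySeq (Real.sqrt (ε / Real.pi))
      (Real.sqrt_pos.2 (div_pos hε Real.pi_pos))
    refine ⟨N, fun m hm n hn => (growth_le_pi_mul_dist_sq hX o (ξ m) (ξ n)).trans ?_⟩
    have := pow_le_pow_left₀ dist_nonneg (hN m hm n hn).le 2
    rw [Real.sq_sqrt (div_pos hε Real.pi_pos).le, le_div_iff₀' Real.pi_pos] at this
    exact this
  have hcauchy : ∀ t : ℝ≥0, CauchySeq fun n => c n t := by
    intro t
    refine Metric.cauchySeq_iff.2 fun ε hε => ?_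
    obtain ⟨N, hN⟩ := hgrowth (ε / (t + 1)) (by positivity)
    refine ⟨N, fun m hm n hn => ?_⟩
    refine (dist_le_growth_mul ((hc0 m).trans (hc0 n).symm) t).trans_lt ?_
    refine (mul_le_mul_of_nonneg_right (hN m hm n hn) t.2).trans_lt ?_
    rw [NNReal.val_eq_coe, div_mul_eq_mul_div, div_lt_iff₀ (by positivity)]
    linarith
  obtain ⟨e, he⟩ := GeodesicRay.exists_of_cauchySeq (u := fun n t => c n t)
    (fun s t => Eventually.of_forall fun n => (c n).dist_eq' s t) hcauchy
  have he0 : e 0 = o :=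
    tendsto_nhds_unique (he 0) (tendsto_const_nhds.congr fun n => (hc0 n).symm)
  refine ⟨e.endpoint, tendsto_nhds_unique ?_ hS⟩
  refine Metric.tendsto_atTop.2 fun ε hε => ?_
  obtain ⟨N, hN⟩ := hgrowth (ε ^ 2 / 2) (by positivity)
  refine ⟨N, fun n hn => lt_of_pow_lt_pow_left₀ 2 hε.le ?_⟩
  have h1 : growth (c n) e ≤ ε ^ 2 / 2 := by
    refine growth_le_of_forall (by positivity) fun t => ?_
    refine le_of_tendsto (tendsto_const_nhds.dist (he t)) ?_
    filter_upwards [eventually_ge_atTop N] with m hm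
    exact (dist_le_growth_mul ((hc0 n).trans (hc0 m).symm) t).trans
      (mul_le_mul_of_nonneg_right (hN n hn m hm) t.2)
  have h2 := sDist_le_growth ((hc0 n).trans he0.symm)
  rw [← cls_image_eq_boundaryMap hX o e, boundaryMap, sq_dist_cls]
  rw [hc0] at h2
  have : 0 < ε ^ 2 := by positivity
  exact (h2.trans h1).trans_lt (by linarith)

end AngleMetric

theorem mainTheorem8 {X : Type*} [MetricSpace X] [CompleteSpace X] (hX : AngleMetric.IsCAT0 X)
    (o : X) :
    (∀ (p : X) (ξ : AngleMetric.Boundary X),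
      ∃! c : AngleMetric.GeodesicRay X, c 0 = p ∧ c.endpoint = ξ) ∧
    Set.BijOn (AngleMetric.boundaryMap o) Set.univ
      (AngleMetric.familyQuot o (AngleMetric.rayImages X)) ∧
    (∀ ξ ζ : AngleMetric.Boundary X,
      1 / Real.pi * AngleMetric.angle ξ ζ
          ≤ dist (AngleMetric.boundaryMap o ξ) (AngleMetric.boundaryMap o ζ) ^ 2 ∧
        dist (AngleMetric.boundaryMap o ξ) (AngleMetric.boundaryMap o ζ) ^ 2
          ≤ AngleMetric.angle ξ ζ) ∧
    IsClosed (AngleMetric.familyQuot o (AngleMetric.rayImages X)) := by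
  rw [AngleMetric.familyQuot_rayImages hX o]
  refine ⟨hX.existsUnique_ray, ?_, fun ξ ζ => ?_, AngleMetric.isClosed_range_boundaryMap hX o⟩
  · rw [← Set.image_univ]
    exact (AngleMetric.injective_boundaryMap hX o).injOn.bijOn_image
  · obtain ⟨h1, h2⟩ := hX.rayFrom_spec o ξ
    obtain ⟨h1', h2'⟩ := hX.rayFrom_spec o ζ
    have h := h1.trans h1'.symm
    have hangle := hX.angle_eq_asymAngle h
    rw [h2, h2'] at hangle
    have hle := hX.asymAngle_le_pi_mul_sDist h
    have hge := hX.sDist_le_asymAngle h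
    rw [h1] at hle hge
    rw [hangle, AngleMetric.boundaryMap, AngleMetric.boundaryMap, AngleMetric.sq_dist_cls]
    refine ⟨?_, hge⟩
    rw [one_div_mul_eq_div, div_le_iff₀' Real.pi_pos]
    exact hle
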